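/- Let $m,n\ge 1$ be integers. The $m$-Catalan arrangement in $\mathbb{R}^n$ is the arrangement of the hyperplanes $x_i-x_j=k$ with $1\le i<j\le n$ and $k\in\{-m,-m+1,\ldots,m\}$. The characteristic polynomial of a hyperplane arrangement $\mathcal{A}$ in $\mathbb{R}^n$ is $\chi_{\mathcal{A}}(t)=\sum_{x}\mu(\hat 0,x)\,t^{\dim x}$, where $x$ runs over the intersection poset of $\mathcal{A}$ (the non-empty intersections of hyperplanes of $\mathcal{A}$, including $\hat 0=\mathbb{R}^n$, ordered by reverse inclusion) and $\mu$ is the Möbius function of this poset. Let $C(m,n,j)$ denote the absolute value of the coefficient of $t^j$ in the characteristic polynomial of the $m$-Catalan arrangement in $\mathbb{R}^n$, and put $C^{(m)}(n):=\sum_{j=1}^{n}C(m,n,j)$. Then $$C^{(m)}(n)=\frac{n!}{mn+1}\binom{(m+1)n}{n},\qquad C^{(m)}(n)\le C(m+1,n,1),\qquad C^{(m)}(n)\le C(m,n+1,1).$$ -/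

import Mathlib

open Polynomial
open scoped Nat

noncomputable section

/-- A hyperplane arrangement in `ℝⁿ`: a finite collection of affine hyperplanes, i.e. of
non-empty affine subspaces whose direction has codimension one. -/
structure HyperplaneArrangement (n : ℕ) where
  hyperplanes : Finset (AffineSubspace ℝ (Fin n → ℝ))
  isHyperplane : ∀ H ∈ hyperplanes,
    (H : Set (Fin n → ℝ)).Nonempty ∧ Module.finrank ℝ H.direction + 1 = n

namespace HyperplaneArrangement

variable {n : ℕ}

/-- `X` is a non-empty intersection of hyperplanes of `A` (the empty family of hyperplanes is
allowed, and its intersection is `ℝⁿ`). -/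
def IsFlat (A : HyperplaneArrangement n) (X : AffineSubspace ℝ (Fin n → ℝ)) : Prop :=
  (X : Set (Fin n → ℝ)).Nonempty ∧
    ∃ B : Finset (AffineSubspace ℝ (Fin n → ℝ)),
      B ⊆ A.hyperplanes ∧ X = sInf (B : Set (AffineSubspace ℝ (Fin n → ℝ)))

/-- The intersection poset of `A`: the non-empty intersections of hyperplanes of `A`, ordered by
reverse inclusion. -/
abbrev IntersectionPoset (A : HyperplaneArrangement n) : Type :=
  {X : AffineSubspace ℝ (Fin n → ℝ) // A.IsFlat X}ᵒᵈ

theorem finite_flats (A : HyperplaneArrangement n) : {X | A.IsFlat X}.Finite := by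
  refine (A.hyperplanes.powerset.finite_toSet.image
    (fun B : Finset (AffineSubspace ℝ (Fin n → ℝ)) =>
      sInf (B : Set (AffineSubspace ℝ (Fin n → ℝ))))).subset ?_
  rintro X ⟨-, B, hB, rfl⟩
  exact ⟨B, by simpa using hB, rfl⟩

instance (A : HyperplaneArrangement n) : Fintype A.IntersectionPoset :=
  letI : Fintype {X : AffineSubspace ℝ (Fin n → ℝ) // A.IsFlat X} := A.finite_flats.fintype
  inferInstanceAs (Fintype {X : AffineSubspace ℝ (Fin n → ℝ) // A.IsFlat X}ᵒᵈ)

instance (A : HyperplaneArrangement n) : DecidableEq A.IntersectionPoset :=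
  Classical.decEq _

open Classical in
instance (A : HyperplaneArrangement n) : LocallyFiniteOrder A.IntersectionPoset :=
  Fintype.toLocallyFiniteOrder

/-- The affine subspace underlying an element of the intersection poset. -/
def flat (A : HyperplaneArrangement n) (X : A.IntersectionPoset) :
    AffineSubspace ℝ (Fin n → ℝ) :=
  (OrderDual.ofDual X).1

/-- The element `ℝⁿ` of the intersection poset, its least element. -/
def zeroHat (A : HyperplaneArrangement n) : A.IntersectionPoset :=
  OrderDual.toDual ⟨⊤, ⟨0, trivial⟩, ∅, by simp, by simp⟩

/-- The characteristic polynomial `χ_A(t) = ∑_{X ∈ L(A)} μ(0̂, X) t ^ dim X`, where `μ` is the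
Möbius function of the intersection poset. -/
def charPoly (A : HyperplaneArrangement n) : ℤ[X] :=
  ∑ X : A.IntersectionPoset,
    C (IncidenceAlgebra.mu ℤ A.zeroHat X) * Polynomial.X ^ Module.finrank ℝ (A.flat X).direction

end HyperplaneArrangement

/-- The affine subspace `x_i - x_j = k` of `ℝⁿ`. -/
def differenceSubspace {n : ℕ} (i j : Fin n) (k : ℤ) : AffineSubspace ℝ (Fin n → ℝ) where
  carrier := {x | x i - x j = k}
  smul_vsub_vadd_mem' := by
    intro c p q r hp hq hr
    change p i - p j = k at hp
    change q i - q j = k at hq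
    change r i - r j = k at hr
    change (c • (p -ᵥ q) +ᵥ r) i - (c • (p -ᵥ q) +ᵥ r) j = k
    simp only [vsub_eq_sub, vadd_eq_add, Pi.add_apply, Pi.smul_apply,
      Pi.sub_apply, smul_eq_mul]
    linear_combination c * hp - c * hq + hr

theorem differenceSubspace_isHyperplane {n : ℕ} {i j : Fin n} (hij : i ≠ j) (k : ℤ) :
    (differenceSubspace i j k : Set (Fin n → ℝ)).Nonempty ∧
      Module.finrank ℝ (differenceSubspace i j k).direction + 1 = n := by
  have h0 : (Pi.single i (k : ℝ) : Fin n → ℝ) ∈ differenceSubspace i j k := by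
    change (Pi.single i (k : ℝ) : Fin n → ℝ) i - (Pi.single i (k : ℝ) : Fin n → ℝ) j = k
    simp [Pi.single_eq_of_ne hij.symm]
  refine ⟨⟨_, h0⟩, ?_⟩
  let f : Module.Dual ℝ (Fin n → ℝ) := (LinearMap.proj i : (Fin n → ℝ) →ₗ[ℝ] ℝ) - LinearMap.proj j
  have hf : f ≠ 0 := by
    intro h
    have := LinearMap.congr_fun h (Pi.single i 1)
    simp [f, Pi.single_eq_of_ne hij.symm] at this
  have hdir : (differenceSubspace i j k).direction = LinearMap.ker f := by
    ext v
    rw [AffineSubspace.mem_direction_iff_eq_vsub_right h0]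
    constructor
    · rintro ⟨x, hx, rfl⟩
      change x i - x j = k at hx
      simp [f, Pi.single_eq_of_ne hij.symm]
      linarith
    · intro hv
      refine ⟨v + Pi.single i (k : ℝ), ?_, by simp⟩
      have hv' : v i - v j = 0 := by simpa [f] using hv
      change (v + Pi.single i (k : ℝ) : Fin n → ℝ) i - (v + Pi.single i (k : ℝ) : Fin n → ℝ) j = k
      simp [Pi.single_eq_of_ne hij.symm]
      linarith
  rw [hdir]
  simpa using Module.Dual.finrank_ker_add_one_of_ne_zero hf

open Classical in
/-- The deformation `A_S(n)` of the braid arrangement: the hyperplanes `x_i - x_j = k` of `ℝⁿ`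
with `k ∈ S` and `i < j`. -/
def braidDeformation (S : Finset ℤ) (n : ℕ) : HyperplaneArrangement n where
  hyperplanes :=
    ((Finset.univ.filter fun p : Fin n × Fin n => p.1 < p.2) ×ˢ S).image
      fun q => differenceSubspace q.1.1 q.1.2 q.2
  isHyperplane := by
    intro H hH
    obtain ⟨q, hq, rfl⟩ := Finset.mem_image.mp hH
    have hlt : q.1.1 < q.1.2 := by simpa using (Finset.mem_product.mp hq).1
    exact differenceSubspace_isHyperplane hlt.ne q.2

/-- The `m`-Catalan arrangement in `ℝⁿ`: `A_S(n)` with `S = {-m, …, m}`. -/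
def catalanArrangement (m n : ℕ) : HyperplaneArrangement n :=
  braidDeformation (Finset.Icc (-(m : ℤ)) (m : ℤ)) n

/-- `C(m, n, j)`: the absolute value of the coefficient of `t ^ j` in the characteristic polynomial
of the `m`-Catalan arrangement in `ℝⁿ`. -/
def catalanCoeff (m n j : ℕ) : ℕ :=
  ((catalanArrangement m n).charPoly.coeff j).natAbs

/-- `C⁽ᵐ⁾(n) = ∑_{j = 1}^{n} C(m, n, j)`. -/
def catalanTotal (m n : ℕ) : ℕ :=
  ∑ j ∈ Finset.Icc 1 n, catalanCoeff m n j

end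

noncomputable section

/-! The proof is the finite field method, without primality. For every integer `q > n * m`, a point
modulo `q` has a smallest flat "containing" it (`flatMod`): it lifts to an integer point with the
same differences of size at most `m` (`exists_lift_differences`). A flat contains an integer point,
so translation makes its equations homogeneous, and it has `q ^ dim` points modulo `q`
(`card_isPointMod`). Möbius summation then shows that `χ(q)` counts the points avoiding all
hyperplanes (`eval_charPoly_catalanArrangement`). After the first coordinate is fixed, such points
are families of residues pairwise more than `m` apart. Closing the gaps turns these into injections
(`separatedInEquiv`), whence `χ(t) = t ∏ (t - mn - k)` over `1 ≤ k < n`. Coefficients alternate in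
sign, so the sum of their absolute values is `∏ (mn + k + 1)`, which gives the formula; both
inequalities follow factor by factor. -/

/-! ### Flats, their dimension and their points modulo `q`. -/

theorem mem_differenceSubspace {n : ℕ} {i j : Fin n} {k : ℤ} {x : Fin n → ℝ} :
    x ∈ differenceSubspace i j k ↔ x i - x j = k := Iff.rfl

theorem mem_catalanArrangement_hyperplanes {m n : ℕ} {H : AffineSubspace ℝ (Fin n → ℝ)} :
    H ∈ (catalanArrangement m n).hyperplanes ↔
      ∃ (i j : Fin n) (k : ℤ), i < j ∧ |k| ≤ m ∧ differenceSubspace i j k = H := by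
  classical
  simp only [catalanArrangement, braidDeformation, Finset.mem_image, Finset.mem_product,
    Finset.mem_filter, Finset.mem_univ, true_and, Finset.mem_Icc, Prod.exists, abs_le, and_assoc]

theorem mem_sInf_affineSubspace {n : ℕ} {S : Set (AffineSubspace ℝ (Fin n → ℝ))}
    {x : Fin n → ℝ} : x ∈ sInf S ↔ ∀ H ∈ S, x ∈ H := by
  rw [← SetLike.mem_coe, AffineSubspace.coe_sInf]
  simp

/-- A point lies on a flat of the Catalan arrangement iff it satisfies every equation of the
arrangement that holds on the flat. -/
theorem mem_flat_iff {m n : ℕ} {X : AffineSubspace ℝ (Fin n → ℝ)}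
    (hX : (catalanArrangement m n).IsFlat X) {x : Fin n → ℝ} :
    x ∈ X ↔ ∀ (i j : Fin n) (k : ℤ), i < j → |k| ≤ m → X ≤ differenceSubspace i j k →
      x i - x j = k := by
  refine ⟨fun hx i j k _ _ h => h hx, fun h => ?_⟩
  obtain ⟨-, B, hB, rfl⟩ := hX
  refine mem_sInf_affineSubspace.2 fun H hH => ?_
  obtain ⟨i, j, k, hij, hk, rfl⟩ := mem_catalanArrangement_hyperplanes.1 (hB hH)
  exact h i j k hij hk (sInf_le hH)

/-- The functions that agree on related points are the functions on the quotient. -/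
def respectingEquiv {ι : Type*} (r : ι → ι → Prop) (R : Type*) :
    {v : ι → R // ∀ i j, r i j → v i = v j} ≃ (Quot r → R) where
  toFun v := Quot.lift v.1 v.2
  invFun w := ⟨fun i => w (Quot.mk r i), fun _ _ h => congrArg w (Quot.sound h)⟩
  left_inv _ := rfl
  right_inv w := by
    ext c
    induction c using Quot.ind
    rfl

/-- Two coordinates are related when one of the equations of the Catalan arrangement that hold on
`X` involves both. -/
def flatRel (m : ℕ) {n : ℕ} (X : AffineSubspace ℝ (Fin n → ℝ)) (i j : Fin n) : Prop :=
  ∃ k : ℤ, i < j ∧ |k| ≤ m ∧ X ≤ differenceSubspace i j k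

theorem mem_direction_flat_iff {m n : ℕ} {X : AffineSubspace ℝ (Fin n → ℝ)}
    (hX : (catalanArrangement m n).IsFlat X) {v : Fin n → ℝ} :
    v ∈ X.direction ↔ ∀ i j, flatRel m X i j → v i = v j := by
  obtain ⟨p, hp⟩ := hX.1
  rw [← AffineSubspace.vadd_mem_iff_mem_direction v hp, mem_flat_iff hX]
  have hp' := (mem_flat_iff hX).1 hp
  constructor
  · rintro h i j ⟨k, hij, hk, hle⟩
    have h1 := h i j k hij hk hle
    have h2 := hp' i j k hij hk hle
    simp only [vadd_eq_add, Pi.add_apply] at h1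
    linarith
  · intro h i j k hij hk hle
    have h1 := h i j ⟨k, hij, hk, hle⟩
    have h2 := hp' i j k hij hk hle
    simp only [vadd_eq_add, Pi.add_apply]
    linarith

theorem finrank_direction_flat {m n : ℕ} {X : AffineSubspace ℝ (Fin n → ℝ)}
    (hX : (catalanArrangement m n).IsFlat X) :
    Module.finrank ℝ X.direction = Nat.card (Quot (flatRel m X)) := by
  classical
  have : Fintype (Quot (flatRel m X)) := Fintype.ofFinite _
  let e : X.direction ≃ₗ[ℝ] (Quot (flatRel m X) → ℝ) :=
    { (Equiv.subtypeEquivRight fun _ => mem_direction_flat_iff hX).trans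
        (respectingEquiv (flatRel m X) ℝ) with
      map_add' := fun v w => by
        ext c
        induction c using Quot.ind
        rfl
      map_smul' := fun a v => by
        ext c
        induction c using Quot.ind
        rfl }
  rw [e.finrank_eq, Module.finrank_fintype_fun_eq_card, Nat.card_eq_fintype_card]

/-- Taking floors preserves integer differences. -/
theorem exists_integer_point_flat {m n : ℕ} {X : AffineSubspace ℝ (Fin n → ℝ)}
    (hX : (catalanArrangement m n).IsFlat X) :
    ∃ y : Fin n → ℤ, ∀ (i j : Fin n) (k : ℤ), i < j → |k| ≤ m → X ≤ differenceSubspace i j k →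
      y i - y j = k := by
  obtain ⟨p, hp⟩ := hX.1
  refine ⟨fun i => ⌊p i⌋, fun i j k _ _ h => ?_⟩
  have h1 : p i = p j + k := by linarith [mem_differenceSubspace.1 (h hp)]
  simp only [h1, Int.floor_add_intCast]
  ring

/-- `x` solves, modulo `q`, the equations of the Catalan arrangement that hold on `X`. -/
def IsPointMod (m q : ℕ) {n : ℕ} (X : AffineSubspace ℝ (Fin n → ℝ)) (x : Fin n → ZMod q) : Prop :=
  ∀ (i j : Fin n) (k : ℤ), i < j → |k| ≤ m → X ≤ differenceSubspace i j k → x i - x j = k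

/-- Subtracting an integer point leaves the functions constant on the classes of `flatRel`; over `ℝ`
the number of classes is the dimension. -/
theorem card_isPointMod {m n : ℕ} (q : ℕ) {X : AffineSubspace ℝ (Fin n → ℝ)}
    (hX : (catalanArrangement m n).IsFlat X) :
    Nat.card {x : Fin n → ZMod q // IsPointMod m q X x} = q ^ Module.finrank ℝ X.direction := by
  obtain ⟨y, hy⟩ := exists_integer_point_flat hX
  have e : {x : Fin n → ZMod q // IsPointMod m q X x} ≃
      {v : Fin n → ZMod q // ∀ i j, flatRel m X i j → v i = v j} := by
    refine (Equiv.subRight fun i => (y i : ZMod q)).subtypeEquiv fun x => ?_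
    simp only [Equiv.subRight_apply, Pi.sub_apply]
    constructor
    · rintro h i j ⟨k, hij, hk, hle⟩
      have h1 := h i j k hij hk hle
      have h2 := hy i j k hij hk hle
      rw [← h2] at h1
      push_cast at h1
      linear_combination h1
    · intro h i j k hij hk hle
      have h1 := h i j ⟨k, hij, hk, hle⟩
      have h2 := hy i j k hij hk hle
      rw [← h2]
      push_cast
      linear_combination h1
  rw [finrank_direction_flat hX, Nat.card_congr (e.trans (respectingEquiv _ _)), Nat.card_fun,
    Nat.card_zmod]

/-! ### The finite field method. -/

/-- When `q > n m`, a point modulo `q` can be lifted to an integer point, up to a translation, so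
that all small differences are preserved. -/
theorem exists_lift_differences {m n q : ℕ} (hq : n * m < q) (x : Fin n → ZMod q) :
    ∃ y : Fin n → ℤ, ∀ (i j : Fin n) (k : ℤ), |k| ≤ m →
      (x i - x j = (k : ZMod q) ↔ y i - y j = k) := by
  classical
  have : NeZero q := ⟨by omega⟩
  -- Pigeonhole: the `n * m` residues at distance `1, …, m` above some `x i` do not exhaust `ZMod
  -- q`. Cutting the circle at such a `c` leaves the last `m` places before `c` empty.
  obtain ⟨c, hc⟩ : ∃ c : ZMod q, ∀ (i : Fin n) (l : Fin m), c ≠ x i + 1 + ((l : ℕ) : ZMod q) := by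
    by_contra! h
    have hs : Function.Surjective
        fun a : Fin n × Fin m => x a.1 + 1 + (((a.2 : Fin m) : ℕ) : ZMod q) := by
      intro c
      obtain ⟨i, l, h⟩ := h c
      exact ⟨(i, l), h.symm⟩
    have := Fintype.card_le_of_surjective _ hs
    simp only [Fintype.card_prod, Fintype.card_fin, ZMod.card] at this
    omega
  have hlt : ∀ i, (x i - c).val + m < q := by
    intro i
    by_contra! h
    have h1 := ZMod.val_lt (x i - c)
    refine hc i ⟨q - 1 - (x i - c).val, by omega⟩ ?_
    have h2 : (((q - 1 - (x i - c).val) + ((x i - c).val + 1) : ℕ) : ZMod q) = (q : ℕ) := by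
      congr 1
      omega
    rw [Nat.cast_add, Nat.cast_add, ZMod.natCast_zmod_val, ZMod.natCast_self, Nat.cast_one] at h2
    linear_combination -h2
  refine ⟨fun i => ((x i - c).val : ℤ), fun i j k hk => ?_⟩
  have hx : x i - x j = (((x i - c).val - (x j - c).val : ℤ) : ZMod q) := by
    push_cast
    simp
  rw [hx, ZMod.intCast_eq_intCast_iff_dvd_sub]
  have hi := hlt i
  have hj := hlt j
  rw [abs_le] at hk
  change _ ↔ ((x i - c).val - (x j - c).val : ℤ) = k
  constructor
  · intro h
    -- Representatives lie in `[0, q - m)`, so their difference minus `k` is smaller than `q` in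
    -- absolute value.
    have := Int.eq_zero_of_abs_lt_dvd h (by rw [abs_lt]; constructor <;> omega)
    omega
  · intro h
    rw [h, sub_self]
    exact dvd_zero _

open Classical in
/-- The hyperplanes of the Catalan arrangement that contain `x` modulo `q`. -/
def hyperplanesMod (m q : ℕ) {n : ℕ} (x : Fin n → ZMod q) :
    Finset (AffineSubspace ℝ (Fin n → ℝ)) :=
  (catalanArrangement m n).hyperplanes.filter fun H => ∃ (i j : Fin n) (k : ℤ),
    i < j ∧ |k| ≤ m ∧ differenceSubspace i j k = H ∧ x i - x j = k

theorem mem_hyperplanesMod {m q n : ℕ} {x : Fin n → ZMod q} {H : AffineSubspace ℝ (Fin n → ℝ)} :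
    H ∈ hyperplanesMod m q x ↔ ∃ (i j : Fin n) (k : ℤ),
      i < j ∧ |k| ≤ m ∧ differenceSubspace i j k = H ∧ x i - x j = k := by
  classical
  simp only [hyperplanesMod, Finset.mem_filter, and_iff_right_iff_imp]
  rintro ⟨i, j, k, hij, hk, h, -⟩
  exact mem_catalanArrangement_hyperplanes.2 ⟨i, j, k, hij, hk, h⟩

/-- The smallest flat of the Catalan arrangement on which `x` lies modulo `q`. -/
def flatMod (m q : ℕ) {n : ℕ} (x : Fin n → ZMod q) : AffineSubspace ℝ (Fin n → ℝ) :=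
  sInf (hyperplanesMod m q x : Set (AffineSubspace ℝ (Fin n → ℝ)))

/-- The lifted point is a generic witness: it shows that `flatMod` is non-empty and that no further
equation of the arrangement holds on it. -/
theorem exists_mem_flatMod {m n q : ℕ} (hq : n * m < q) (x : Fin n → ZMod q) :
    ∃ p ∈ flatMod m q x, ∀ (i j : Fin n) (k : ℤ), |k| ≤ m →
      (p ∈ differenceSubspace i j k ↔ x i - x j = k) := by
  obtain ⟨y, hy⟩ := exists_lift_differences hq x
  have key : ∀ (i j : Fin n) (k : ℤ), |k| ≤ m →
      ((fun i => (y i : ℝ)) ∈ differenceSubspace i j k ↔ x i - x j = k) := by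
    intro i j k hk
    rw [hy i j k hk, mem_differenceSubspace]
    exact_mod_cast Iff.rfl
  refine ⟨fun i => (y i : ℝ), mem_sInf_affineSubspace.2 fun H hH => ?_, key⟩
  obtain ⟨i, j, k, -, hk, rfl, h⟩ := mem_hyperplanesMod.1 hH
  exact (key i j k hk).2 h

theorem isFlat_flatMod {m n q : ℕ} (hq : n * m < q) (x : Fin n → ZMod q) :
    (catalanArrangement m n).IsFlat (flatMod m q x) := by
  classical
  obtain ⟨p, hp, -⟩ := exists_mem_flatMod hq x
  exact ⟨⟨p, hp⟩, _, Finset.filter_subset _ _, rfl⟩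

theorem flatMod_le_iff {m n q : ℕ} (hq : n * m < q) (x : Fin n → ZMod q)
    {X : AffineSubspace ℝ (Fin n → ℝ)} (hX : (catalanArrangement m n).IsFlat X) :
    flatMod m q x ≤ X ↔ IsPointMod m q X x := by
  constructor
  · intro h i j k hij hk hle
    obtain ⟨p, hp, hp'⟩ := exists_mem_flatMod hq x
    exact (hp' i j k hk).1 (hle (h hp))
  · intro h p hp
    refine (mem_flat_iff hX).2 fun i j k hij hk hle => ?_
    exact mem_sInf_affineSubspace.1 hp _
      (mem_hyperplanesMod.2 ⟨i, j, k, hij, hk, rfl, h i j k hij hk hle⟩)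

theorem flatMod_eq_top_iff {m n q : ℕ} (x : Fin n → ZMod q) :
    flatMod m q x = ⊤ ↔ ∀ (i j : Fin n) (k : ℤ), i < j → |k| ≤ m → x i - x j ≠ k := by
  constructor
  · intro h i j k hij hk hx
    have h1 : flatMod m q x ≤ differenceSubspace i j k :=
      sInf_le (mem_hyperplanesMod.2 ⟨i, j, k, hij, hk, rfl, hx⟩)
    rw [h] at h1
    have h2 : ((0 : Fin n → ℝ)) ∈ differenceSubspace i j k := h1 trivial
    have h3 : (Pi.single i 1 : Fin n → ℝ) ∈ differenceSubspace i j k := h1 trivial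
    rw [mem_differenceSubspace] at h2 h3
    simp [hij.ne'] at h2 h3
    rw [← h2] at h3
    simp at h3
  · intro h
    refine sInf_eq_top.2 fun H hH => ?_
    obtain ⟨i, j, k, hij, hk, -, hx⟩ := mem_hyperplanesMod.1 hH
    exact absurd hx (h i j k hij hk)

/-- The finite field method: the characteristic polynomial of the Catalan arrangement counts the
points modulo a large `q` on no hyperplane. -/
theorem eval_charPoly_catalanArrangement {m n q : ℕ} (hq : n * m < q) :
    (catalanArrangement m n).charPoly.eval (q : ℤ) =
      Nat.card {x : Fin n → ZMod q //
        ∀ (i j : Fin n) (k : ℤ), i < j → |k| ≤ m → x i - x j ≠ k} := by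
  classical
  have : NeZero q := ⟨by omega⟩
  set A := catalanArrangement m n
  let F : (Fin n → ZMod q) → A.IntersectionPoset := fun x =>
    OrderDual.toDual ⟨flatMod m q x, isFlat_flatMod hq x⟩
  have hF : ∀ x (X : A.IntersectionPoset), X ≤ F x ↔ IsPointMod m q (A.flat X) x := fun x X =>
    flatMod_le_iff hq x (OrderDual.ofDual X).2
  have h0 : ∀ X : A.IntersectionPoset, A.zeroHat ≤ X := fun X =>
    show (OrderDual.ofDual X).1 ≤ ⊤ from le_top
  have hpow : ∀ X : A.IntersectionPoset, ((q : ℤ) ^ Module.finrank ℝ (A.flat X).direction) =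
      ∑ x : Fin n → ZMod q, if X ≤ F x then 1 else 0 := by
    intro X
    have := card_isPointMod q (OrderDual.ofDual X).2
    rw [Finset.sum_boole]
    rw [Nat.card_eq_fintype_card, Fintype.card_subtype] at this
    simp only [hF]
    exact_mod_cast this.symm
  have hsum : ∀ x, ∑ X : A.IntersectionPoset,
      (if X ≤ F x then IncidenceAlgebra.mu ℤ A.zeroHat X else 0) =
      if A.zeroHat = F x then 1 else 0 := by
    intro x
    -- The flats `X ≤ F x` form the interval from `zeroHat` to `F x`, over which `mu` sums to zero
    -- unless the ends coincide.
    rw [← IncidenceAlgebra.sum_Icc_mu_right, ← Finset.sum_filter]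
    refine Finset.sum_congr ?_ fun _ _ => rfl
    ext X
    simp [h0]
  have htop : ∀ x, A.zeroHat = F x ↔
      ∀ (i j : Fin n) (k : ℤ), i < j → |k| ≤ m → x i - x j ≠ k := by
    intro x
    rw [← flatMod_eq_top_iff]
    constructor
    · intro h
      exact (congrArg A.flat h).symm
    · intro h
      exact congrArg OrderDual.toDual (Subtype.ext h.symm)
  calc A.charPoly.eval (q : ℤ)
      = ∑ X : A.IntersectionPoset, ∑ x : Fin n → ZMod q,
          if X ≤ F x then IncidenceAlgebra.mu ℤ A.zeroHat X else 0 := by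
        simp only [HyperplaneArrangement.charPoly, eval_finsetSum, eval_mul, eval_C, eval_pow,
          eval_X, hpow, Finset.mul_sum, mul_ite, mul_one, mul_zero]
    _ = ∑ x : Fin n → ZMod q, if A.zeroHat = F x then 1 else 0 := by
        rw [Finset.sum_comm]
        exact Finset.sum_congr rfl fun x _ => hsum x
    _ = _ := by
        rw [Finset.sum_boole, Nat.card_eq_fintype_card, Fintype.card_subtype]
        simp only [htop]

/-! ### Counting separated families by closing gaps. -/

/-- The number of indices at which `v` is smaller than at `i`. -/
def rankBelow {N : ℕ} (v : Fin N → ℕ) (i : Fin N) : ℕ :=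
  (Finset.univ.filter fun j => v j < v i).card

theorem rankBelow_congr {N : ℕ} {v w : Fin N → ℕ} (h : ∀ i j, v i < v j ↔ w i < w j) (i : Fin N) :
    rankBelow v i = rankBelow w i := by
  simp only [rankBelow, h]

theorem rankBelow_add_card {N : ℕ} (v : Fin N → ℕ) {i j : Fin N} (h : v i ≤ v j) :
    rankBelow v j =
      rankBelow v i + (Finset.univ.filter fun l => v i ≤ v l ∧ v l < v j).card := by
  rw [rankBelow, rankBelow, ← Finset.card_union_of_disjoint]
  · congr 1
    ext l
    simp only [Finset.mem_filter, Finset.mem_univ, true_and, Finset.mem_union]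
    omega
  · refine Finset.disjoint_filter.2 fun l _ h1 h2 => ?_
    omega

theorem rankBelow_add_card_ge {N : ℕ} (v : Fin N → ℕ) (i : Fin N) :
    rankBelow v i + (Finset.univ.filter fun l => v i ≤ v l).card = N := by
  have h := Finset.card_filter_add_card_filter_not (s := (Finset.univ : Finset (Fin N)))
    (fun l => v l < v i)
  simpa only [rankBelow, not_lt, Finset.card_univ, Fintype.card_fin] using h

theorem rankBelow_lt_rankBelow {N : ℕ} {v : Fin N → ℕ} {i j : Fin N} (h : v i < v j) :
    rankBelow v i < rankBelow v j := by
  rw [rankBelow_add_card v h.le, Nat.lt_add_right_iff_pos, Finset.card_pos]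
  exact ⟨i, by simp [h]⟩

theorem rankBelow_lt {N : ℕ} (v : Fin N → ℕ) (i : Fin N) : rankBelow v i < N := by
  have h := rankBelow_add_card_ge v i
  have : 0 < (Finset.univ.filter fun l => v i ≤ v l).card := Finset.card_pos.2 ⟨i, by simp⟩
  omega

/-- The values of `v` differ pairwise by more than `m`. -/
def Separated (m : ℕ) {N : ℕ} (v : Fin N → ℕ) : Prop :=
  ∀ i j, i ≠ j → v i + m < v j ∨ v j + m < v i

/-- Disjoint intervals of length `m + 1` fit into an interval only if their total length does. -/
theorem Separated.card_mul_add_le {m N : ℕ} {v : Fin N → ℕ} (hv : Separated m v)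
    (s : Finset (Fin N)) {a b : ℕ} (hab : a ≤ b) (hs : ∀ l ∈ s, a ≤ v l ∧ v l + m < b) :
    s.card * (m + 1) + a ≤ b := by
  have h1 : (s.biUnion fun l => Finset.Icc (v l) (v l + m)).card = s.card * (m + 1) := by
    rw [Finset.card_biUnion]
    · simp [Nat.card_Icc, add_assoc]
    · intro i _ j _ hij
      rw [Function.onFun, Finset.disjoint_left]
      intro a ha hb
      rw [Finset.mem_Icc] at ha hb
      rcases hv i j hij with h | h <;> omega
  have h2 : (s.biUnion fun l => Finset.Icc (v l) (v l + m)) ⊆ Finset.Ico a b := by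
    intro c hc
    obtain ⟨l, hl, hc⟩ := Finset.mem_biUnion.1 hc
    have := hs l hl
    rw [Finset.mem_Icc] at hc
    rw [Finset.mem_Ico]
    omega
  have h3 := Finset.card_le_card h2
  rw [h1, Nat.card_Ico] at h3
  omega

theorem Separated.add_lt {m N : ℕ} {v : Fin N → ℕ} (hv : Separated m v) {i j : Fin N}
    (h : v i < v j) : v i + m < v j := by
  rcases hv i j (by rintro rfl; omega) with h' | h' <;> omega

/-- Separated families with values in `[m + 1, q - m - 1]`. -/
def SeparatedIn (m q : ℕ) {N : ℕ} (v : Fin N → ℕ) : Prop :=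
  (∀ i, m < v i ∧ v i + m < q) ∧ Separated m v

theorem SeparatedIn.rank_mul_le {m q N : ℕ} {v : Fin N → ℕ} (hv : SeparatedIn m q v) (i : Fin N) :
    1 + m * (rankBelow v i + 1) ≤ v i := by
  have h1 := hv.1 i
  have := hv.2.card_mul_add_le (Finset.univ.filter fun j => v j < v i) (a := m + 1) (b := v i)
    (by omega) (fun l hl => by
      have h := (hv.1 l).1
      exact ⟨h, hv.2.add_lt (by simpa using hl)⟩)
  change rankBelow v i * (m + 1) + _ ≤ _ at this
  nlinarith

theorem SeparatedIn.sub_rank_lt {m q N : ℕ} {v : Fin N → ℕ} (hv : SeparatedIn m q v)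
    (i : Fin N) : v i + (N + 1) * m + 1 ≤ q + m * (rankBelow v i + 1) := by
  have h1 := hv.1 i
  have h2 := hv.2.card_mul_add_le (Finset.univ.filter fun j => v i ≤ v j) (a := v i) (b := q)
    (by omega) (fun l hl => ⟨by simpa using hl, (hv.1 l).2⟩)
  have h3 := rankBelow_add_card_ge v i
  have h4 : 0 < (Finset.univ.filter fun l => v i ≤ v l).card := Finset.card_pos.2 ⟨i, by simp⟩
  set s := (Finset.univ.filter fun l => v i ≤ v l).card
  have h5 : (N + 1) * m = rankBelow v i * m + s * m + m := by
    rw [add_mul, one_mul, ← add_mul, h3]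
  nlinarith

/-- Closing the gaps in a separated family, by moving each value down past `m` units for
itself and for each smaller one. -/
def closeGaps (m : ℕ) {N : ℕ} (v : Fin N → ℕ) (i : Fin N) : ℕ :=
  v i - (1 + m * (rankBelow v i + 1))

/-- Opening gaps in an injective family. -/
def openGaps (m : ℕ) {N : ℕ} (w : Fin N → ℕ) (i : Fin N) : ℕ :=
  w i + (1 + m * (rankBelow w i + 1))

/-- If the ranks differ by `s ≥ 1`, the values differ by at least `s * (m + 1)`, while closing the
gaps shrinks the difference by only `s * m`. -/
theorem SeparatedIn.closeGaps_lt {m q N : ℕ} {v : Fin N → ℕ} (hv : SeparatedIn m q v)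
    {i j : Fin N} (h : v i < v j) : closeGaps m v i < closeGaps m v j := by
  have h1 := hv.rank_mul_le i
  have h2 := hv.rank_mul_le j
  have h3 := hv.2.card_mul_add_le (Finset.univ.filter fun l => v i ≤ v l ∧ v l < v j) h.le
    (fun l hl => by
      obtain ⟨h4, h5⟩ := (Finset.mem_filter.1 hl).2
      exact ⟨h4, hv.2.add_lt h5⟩)
  have h4 := rankBelow_lt_rankBelow h
  have h5 := rankBelow_add_card v h.le
  set s := (Finset.univ.filter fun l => v i ≤ v l ∧ v l < v j).card
  have h6 : v i + m * (rankBelow v j + 1) < v j + m * (rankBelow v i + 1) := by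
    rw [h5] at h4 ⊢
    nlinarith
  simp only [closeGaps]
  omega

theorem SeparatedIn.lt_iff_closeGaps_lt {m q N : ℕ} {v : Fin N → ℕ} (hv : SeparatedIn m q v)
    (i j : Fin N) : v i < v j ↔ closeGaps m v i < closeGaps m v j := by
  refine ⟨hv.closeGaps_lt, fun h => ?_⟩
  by_contra! h'
  rcases h'.lt_or_eq with h' | h'
  · exact lt_asymm h (hv.closeGaps_lt h')
  · have : j = i := by
      by_contra hne
      rcases hv.2 j i hne with h'' | h'' <;> omega
    subst this
    exact lt_irrefl _ h

theorem openGaps_add_lt (m : ℕ) {N : ℕ} {w : Fin N → ℕ} {i j : Fin N} (h : w i < w j) :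
    openGaps m w i + m < openGaps m w j := by
  have := rankBelow_lt_rankBelow h
  simp only [openGaps]
  nlinarith

theorem lt_iff_openGaps_lt (m : ℕ) {N : ℕ} {w : Fin N → ℕ} (hw : Function.Injective w)
    (i j : Fin N) : w i < w j ↔ openGaps m w i < openGaps m w j := by
  refine ⟨fun h => by have := openGaps_add_lt m h; omega, fun h => ?_⟩
  by_contra! h'
  rcases h'.lt_or_eq with h' | h'
  · have := openGaps_add_lt m h'
    omega
  · rw [hw h'] at h
    exact lt_irrefl _ h

theorem separatedIn_openGaps {m q N : ℕ} {w : Fin N → ℕ} (hw : Function.Injective w)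
    (hb : ∀ i, w i < q - 1 - (N + 1) * m) : SeparatedIn m q (openGaps m w) := by
  refine ⟨fun i => ?_, fun i j hij => ?_⟩
  · have h1 := hb i
    have h2 := rankBelow_lt w i
    simp only [openGaps]
    have h3 : m * (rankBelow w i + 1) ≤ m * N := Nat.mul_le_mul_left _ h2
    have h4 : (N + 1) * m = m * N + m := by ring
    have h5 : m * (rankBelow w i + 1) = m * rankBelow w i + m := by ring
    omega
  · rcases lt_or_gt_of_ne (hw.ne hij) with h | h
    · exact Or.inl (openGaps_add_lt m h)
    · exact Or.inr (openGaps_add_lt m h)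

/-- Closing the gaps is a bijection from separated to injective families. -/
def separatedInEquiv (m q N : ℕ) :
    {v : Fin N → ℕ // SeparatedIn m q v} ≃ (Fin N ↪ Fin (q - 1 - (N + 1) * m)) where
  toFun v := ⟨fun i => ⟨closeGaps m v.1 i, by
      have h1 := v.2.rank_mul_le i
      have h2 := v.2.sub_rank_lt i
      simp only [closeGaps]
      omega⟩, fun i j h => by
      have h' : closeGaps m v.1 i = closeGaps m v.1 j := congrArg Fin.val h
      by_contra hij
      rcases v.2.2 i j hij with h1 | h1
      · exact (v.2.closeGaps_lt (i := i) (j := j) (by omega)).ne h'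
      · exact (v.2.closeGaps_lt (i := j) (j := i) (by omega)).ne h'.symm⟩
  invFun w := ⟨openGaps m fun i => (w i : ℕ),
    separatedIn_openGaps (Fin.val_injective.comp w.injective) fun i => (w i).2⟩
  left_inv v := by
    ext i
    change closeGaps m v.1 i + (1 + m * (rankBelow (closeGaps m v.1) i + 1)) = v.1 i
    rw [← rankBelow_congr v.2.lt_iff_closeGaps_lt, closeGaps,
      Nat.sub_add_cancel (v.2.rank_mul_le i)]
  right_inv w := by
    ext i
    have hw : Function.Injective fun i => (w i : ℕ) := Fin.val_injective.comp w.injective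
    change openGaps m (fun i => (w i : ℕ)) i -
      (1 + m * (rankBelow (openGaps m fun i => (w i : ℕ)) i + 1)) = w i
    rw [← rankBelow_congr (lt_iff_openGaps_lt m hw), openGaps, Nat.add_sub_cancel]

theorem card_separatedIn (m q N : ℕ) :
    Nat.card {v : Fin N → ℕ // SeparatedIn m q v} = (q - 1 - (N + 1) * m).descFactorial N := by
  rw [Nat.card_congr (separatedInEquiv m q N), Nat.card_eq_fintype_card, Fintype.card_embedding_eq,
    Fintype.card_fin, Fintype.card_fin]

/-! ### Points modulo `q` on no hyperplane. -/

theorem natCast_sub_natCast_ne_iff {m q u v : ℕ} (hu : u < q) (hv : v < q) :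
    (∀ k : ℤ, |k| ≤ m → (u : ZMod q) - v ≠ k) ↔
      (u + m < v ∧ v + m < u + q) ∨ (v + m < u ∧ u + m < v + q) := by
  have key : ∀ k : ℤ, (u : ZMod q) - v = k ↔ (q : ℤ) ∣ k - (u - v) := by
    intro k
    rw [← ZMod.intCast_eq_intCast_iff_dvd_sub]
    push_cast
    rfl
  simp only [Ne, key]
  constructor
  · intro h
    by_contra hc
    -- As `u, v < q`, only these three lifts of the residue can have size at most `m`, apart from
    -- cases already covered by them.
    have h1 := h (u - v)
    have h2 := h (u - v - q)
    have h3 := h (u - v + q)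
    simp only [sub_self, dvd_zero, not_true_eq_false, imp_false, abs_le, not_and] at h1
    have e2 : ((u : ℤ) - v - q - (u - v)) = -q := by ring
    have e3 : ((u : ℤ) - v + q - (u - v)) = q := by ring
    simp only [e2, e3, dvd_neg, dvd_refl, not_true_eq_false, imp_false, abs_le, not_and] at h2 h3
    omega
  · intro h k hk hd
    rw [abs_le] at hk
    have := Int.eq_zero_of_abs_lt_dvd (x := k - (u - v)) hd (by rw [abs_lt]; constructor <;> omega)
    omega

/-- `x` lies modulo `q` on no hyperplane of the Catalan arrangement. -/
def AvoidsMod (m q : ℕ) {n : ℕ} (x : Fin n → ZMod q) : Prop :=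
  ∀ (i j : Fin n) (k : ℤ), i < j → |k| ≤ m → x i - x j ≠ k

/-- Avoiding the first coordinate confines the others to `[m + 1, q - m - 1]`, which makes the
wrap-around conditions between them automatic. -/
theorem avoidsMod_cons_iff {m q N : ℕ} (c : ZMod q) {v : Fin N → ℕ} (hq : 0 < q)
    (hv : ∀ i, v i < q) :
    AvoidsMod m q (Fin.cons c fun i => c + (v i : ZMod q) : Fin (N + 1) → ZMod q) ↔
      SeparatedIn m q v := by
  have h0 : ∀ i, (∀ k : ℤ, |k| ≤ m → c - (c + (v i : ZMod q)) ≠ k) ↔ m < v i ∧ v i + m < q := by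
    intro i
    have h := natCast_sub_natCast_ne_iff (m := m) hq (hv i)
    have e : c - (c + (v i : ZMod q)) = ((0 : ℕ) : ZMod q) - v i := by
      push_cast
      ring
    rw [e, h]
    have := hv i
    omega
  have h1 : ∀ i j, (∀ k : ℤ, |k| ≤ m → c + (v i : ZMod q) - (c + (v j : ZMod q)) ≠ k) ↔
      (v i + m < v j ∧ v j + m < v i + q) ∨ (v j + m < v i ∧ v i + m < v j + q) := by
    intro i j
    rw [add_sub_add_left_eq_sub]
    exact natCast_sub_natCast_ne_iff (hv i) (hv j)
  constructor
  · intro h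
    refine ⟨fun i => (h0 i).1 fun k hk => h 0 i.succ k (Fin.succ_pos i) hk, fun i j hij => ?_⟩
    rcases lt_or_gt_of_ne hij with hij | hij
    · have := (h1 i j).1 fun k hk => h i.succ j.succ k (Fin.succ_lt_succ_iff.2 hij) hk
      omega
    · have := (h1 j i).1 fun k hk => h j.succ i.succ k (Fin.succ_lt_succ_iff.2 hij) hk
      omega
  · intro h i j k hij hk
    induction j using Fin.cases with
    | zero => exact absurd hij (Fin.not_lt_zero i)
    | succ j =>
      induction i using Fin.cases with
      | zero => exact (h0 j).2 (h.1 j) k hk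
      | succ i =>
        refine (h1 i j).2 ?_ k hk
        have := h.1 i
        have := h.1 j
        have := h.2 i j (Fin.succ_lt_succ_iff.1 hij).ne
        omega

/-- A point modulo `q` on no hyperplane is given by its first coordinate and the distances of the
others from it. -/
def avoidsModEquiv (m q N : ℕ) [NeZero q] :
    {x : Fin (N + 1) → ZMod q // AvoidsMod m q x} ≃
      ZMod q × {v : Fin N → ℕ // SeparatedIn m q v} where
  toFun x := (x.1 0, ⟨fun i => (x.1 i.succ - x.1 0).val, by
    rw [← avoidsMod_cons_iff (x.1 0) (NeZero.pos q) fun i => ZMod.val_lt _]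
    convert x.2
    ext i
    induction i using Fin.cases <;> simp⟩)
  invFun p := ⟨Fin.cons p.1 fun i => p.1 + (p.2.1 i : ZMod q),
    (avoidsMod_cons_iff p.1 (NeZero.pos q) fun i => by have := (p.2.2.1 i).2; omega).2 p.2.2⟩
  left_inv x := by
    ext i
    induction i using Fin.cases <;> simp
  right_inv p := by
    refine Prod.ext rfl (Subtype.ext (funext fun i => ?_))
    have h : p.2.1 i < q := by have := (p.2.2.1 i).2; omega
    simp [ZMod.val_cast_of_lt h]

theorem card_avoidsMod (m q N : ℕ) [NeZero q] :
    Nat.card {x : Fin (N + 1) → ZMod q // AvoidsMod m q x} =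
      q * (q - 1 - (N + 1) * m).descFactorial N := by
  rw [Nat.card_congr (avoidsModEquiv m q N), Nat.card_prod, Nat.card_zmod, card_separatedIn]

/-! ### The characteristic polynomial and its coefficients. -/

theorem charPoly_catalanArrangement (m N : ℕ) :
    (catalanArrangement m (N + 1)).charPoly =
      X * ∏ k ∈ Finset.range N, (X - C ((((N + 1) * m + 1 + k : ℕ) : ℤ))) := by
  refine eq_of_infinite_eval_eq _ _ ?_
  have hinj : Function.Injective fun t : ℕ => ((((N + 1) * m + 1 + N + t : ℕ)) : ℤ) := by
    intro a b h
    simpa using h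
  -- These `q` exceed `n * m` and are large enough that no natural subtraction in the falling
  -- factorial truncates.
  refine (Set.infinite_range_of_injective hinj).mono ?_
  rintro _ ⟨t, rfl⟩
  set q := (N + 1) * m + 1 + N + t with hq
  have : NeZero q := ⟨by omega⟩
  have h1 := eval_charPoly_catalanArrangement (m := m) (n := N + 1) (q := q) (by omega)
  have h2 := card_avoidsMod m q N
  simp only [AvoidsMod] at h2
  change eval (q : ℤ) _ = eval (q : ℤ) _
  rw [h1, h2, Nat.descFactorial_eq_prod_range, eval_mul, eval_X, eval_prod, Nat.cast_mul,
    Nat.cast_prod]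
  congr 1
  refine Finset.prod_congr rfl fun k hk => ?_
  rw [Finset.mem_range] at hk
  simp only [eval_sub, eval_X, eval_C]
  rw [Nat.sub_sub, Nat.sub_sub, Nat.cast_sub (by omega)]
  push_cast
  ring

theorem coeff_prod_X_sub_C_natCast (a : ℕ → ℕ) (N j : ℕ) :
    (∏ k ∈ Finset.range N, (X - C (a k : ℤ))).coeff j =
      (-1 : ℤ) ^ (j + N) * (((∏ k ∈ Finset.range N, (X + C (a k)) : ℕ[X]).coeff j : ℕ) : ℤ) := by
  induction N generalizing j with
  | zero =>
    rcases j with _ | j <;> simp [coeff_one]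
  | succ N ih =>
    rw [Finset.prod_range_succ, Finset.prod_range_succ]
    rcases j with _ | j
    · simp only [mul_sub, mul_add, coeff_sub, coeff_add, mul_coeff_zero, coeff_X_zero, coeff_C_zero,
        ih]
      push_cast
      ring
    · rw [coeff_mul_X_sub_C, mul_add, coeff_add, coeff_mul_X, coeff_mul_C, ih, ih]
      push_cast
      ring

theorem catalanCoeff_succ (m N j : ℕ) :
    catalanCoeff m (N + 1) (j + 1) =
      (∏ k ∈ Finset.range N, (X + C ((N + 1) * m + 1 + k)) : ℕ[X]).coeff j := by
  rw [catalanCoeff, charPoly_catalanArrangement, coeff_X_mul, coeff_prod_X_sub_C_natCast,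
    Int.natAbs_mul, Int.natAbs_pow, Int.natAbs_neg, Int.natAbs_one, one_pow, one_mul,
    Int.natAbs_natCast]

theorem catalanCoeff_one (m N : ℕ) :
    catalanCoeff m (N + 1) 1 = ∏ k ∈ Finset.range N, ((N + 1) * m + 1 + k) := by
  rw [show catalanCoeff m (N + 1) 1 = _ from catalanCoeff_succ m N 0, coeff_zero_eq_eval_zero, eval_prod]
  simp

/-- The sum of the coefficients is the value at `1`, which raises each constant term by one. -/
theorem catalanTotal_eq_prod (m N : ℕ) :
    catalanTotal m (N + 1) = ∏ k ∈ Finset.range N, ((N + 1) * m + 2 + k) := by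
  have hdeg : (∏ k ∈ Finset.range N, (X + C ((N + 1) * m + 1 + k)) : ℕ[X]).natDegree < N + 1 := by
    rw [Nat.lt_succ_iff]
    refine (natDegree_prod_le _ _).trans ?_
    simp only [natDegree_X_add_C, Finset.sum_const, Finset.card_range, smul_eq_mul, mul_one, le_refl]
  have h := eval_eq_sum_range' hdeg 1
  rw [eval_prod] at h
  rw [catalanTotal, ← Finset.Ico_add_one_right_eq_Icc, Finset.sum_Ico_eq_sum_range]
  simp only [one_pow, mul_one, eval_add, eval_X, eval_C] at h
  calc _ = ∑ j ∈ Finset.range (N + 1),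
        (∏ k ∈ Finset.range N, (X + C ((N + 1) * m + 1 + k)) : ℕ[X]).coeff j := by
        refine Finset.sum_congr (by simp) fun j _ => ?_
        rw [add_comm 1 j, catalanCoeff_succ]
    _ = _ := by
        rw [← h]
        exact Finset.prod_congr rfl fun k _ => by ring

theorem catalanTotal_mul_factorial (m N : ℕ) :
    ((N + 1) * m + 1)! * catalanTotal m (N + 1) = ((m + 1) * (N + 1))! := by
  rw [catalanTotal_eq_prod, ← Nat.ascFactorial_eq_prod_range, Nat.factorial_mul_ascFactorial]
  congr 1
  ring

end

theorem mainTheorem7 (m n : ℕ) (hm : 1 ≤ m) (hn : 1 ≤ n) :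
    (catalanTotal m n : ℚ) = (n ! : ℚ) / ((m : ℚ) * n + 1) * (((m + 1) * n).choose n : ℚ) ∧
      catalanTotal m n ≤ catalanCoeff (m + 1) n 1 ∧
      catalanTotal m n ≤ catalanCoeff m (n + 1) 1 := by
  obtain ⟨N, rfl⟩ : ∃ N, n = N + 1 := ⟨n - 1, by omega⟩
  refine ⟨?_, ?_, ?_⟩
  · have h1 := catalanTotal_mul_factorial m N
    have h2 := Nat.choose_mul_factorial_mul_factorial
      (show N + 1 ≤ (m + 1) * (N + 1) from Nat.le_mul_of_pos_left _ m.succ_pos)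
    rw [show (m + 1) * (N + 1) - (N + 1) = (N + 1) * m by
      rw [add_one_mul, Nat.add_sub_cancel, mul_comm], ← h1, Nat.factorial_succ ((N + 1) * m)] at h2
    have h3 : (m : ℚ) * ((N + 1 : ℕ) : ℚ) + 1 ≠ 0 := by positivity
    have h4 : ((((N + 1) * m)! : ℕ) : ℚ) ≠ 0 := Nat.cast_ne_zero.2 (Nat.factorial_ne_zero _)
    have h5 : ((((m + 1) * (N + 1)).choose (N + 1) : ℕ) : ℚ) * (((N + 1)! : ℕ) : ℚ) *
        ((((N + 1) * m)! : ℕ) : ℚ) = ((m : ℚ) * ((N + 1 : ℕ) : ℚ) + 1) *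
          ((((N + 1) * m)! : ℕ) : ℚ) * (catalanTotal m (N + 1) : ℚ) := by
      rw [mul_comm (m : ℚ)]
      exact_mod_cast h2
    rw [div_mul_eq_mul_div, eq_div_iff h3]
    refine mul_right_cancel₀ h4 ?_
    linear_combination -h5
  · rw [catalanTotal_eq_prod, catalanCoeff_one]
    refine Finset.prod_le_prod' fun k _ => ?_
    rw [mul_add]
    omega
  -- The right side has one factor more; its smallest, at `k = 0`, is split off and the others are
  -- compared after a shift.
  · rw [catalanTotal_eq_prod, catalanCoeff_one, Finset.prod_range_succ']
    refine (Finset.prod_le_prod' fun k _ => ?_).trans (Nat.le_mul_of_pos_right _ (by omega))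
    rw [add_mul (N + 1) 1 m]
    omega
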